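/- An $m\times n$ Gaussian random matrix is one whose entries are independent $N(0,1)$ random variables. For a real matrix $(w_{ij})$ and the submatrix $U$ with finite row set $A$ and column set $B$, put $$G(U)=\min_{a,b,c}\ \frac{1}{(|A|-1)(|B|-1)}\sum_{i\in A,\,j\in B}(w_{ij}-a_i-b_j-c)^2,$$ the minimum being over all real constants $\{a_i\}_{i\in A}$, $\{b_j\}_{j\in B}$ and $c$ (a submatrix with a single row or a single column is fitted perfectly and is given $G(U)=0$; likewise for the empty submatrix). For $\alpha>0$, $\beta\ge 1$, $0<\tau<1$ and $n\ge1$ let $W$ be a $\lceil \alpha n\rceil\times n$ Gaussian random matrix, and let $L_\tau(W:n,\alpha,\beta)$ be the largest integer $k\ge 0$ such that $W$ contains a (not necessarily contiguous) $\lceil\beta k\rceil\times k$ submatrix $U$ with $G(U)\le\tau$. Let $h(\tau)=1-\tau-\ln(2-\tau)$. **Proposition.** Let $0<\tau<1$ and $\beta\ge 1$. There is a constant $C_2(\beta,\tau)>0$, depending only on $\beta$ and $\tau$, such that for every $\alpha>0$ and every $\epsilon>0$, when $n$ is sufficiently large (depending on $\tau,\alpha,\beta,\epsilon$), $$P\bigl(L_\tau(W:n,\alpha,\beta)\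 \ge\ t(n,\tau,\alpha,\beta)+r\bigr)\ \le\ n^{-(\beta+1)r}\left(\frac{\ln n}{h(\tau)}\right)^{(\beta+1+\epsilon)r}$$ for every real $r$ with $1\le r\le n$, where $$t(n,\tau,\alpha,\beta)=\frac{2(1+\beta^{-1})}{h(\tau)}\ln n-\frac{2(1+\beta^{-1})}{h(\tau)}\ln\left[\frac{2(1+\beta^{-1})}{h(\tau)}\ln n\right]+\frac{\ln\alpha}{h(\tau)}+C_2(\beta,\tau).$$ -/

import Mathlib

open MeasureTheory ProbabilityTheory

noncomputable section

/-- A Gaussian random matrix: the entries are independent and each has law `N(0,1)`. -/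
structure IsGaussianMatrix {Ω ι κ : Type*} [MeasurableSpace Ω] (P : Measure Ω)
    (W : Ω → Matrix ι κ ℝ) : Prop where
  hasLaw : ∀ i j, HasLaw (fun ω => W ω i j) (gaussianReal 0 1) P
  indep : iIndepFun (fun (p : ι × κ) ω => W ω p.1 p.2) P

/-- The ANOVA criterion `G(U)` of the submatrix `U` of `w` with rows `A` and columns `B`:
the minimum over all row effects `a`, column effects `b` and constants `c` of the normalized
residual sum of squares. (Only the values of `a` on `A` and of `b` on `B` matter. If `A` or `B`
has exactly one element the fit is perfect, and `0 / 0` is read as `0`.) -/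
def anovaFit {ι κ : Type*} (w : Matrix ι κ ℝ) (A : Finset ι) (B : Finset κ) : ℝ :=
  ⨅ p : (ι → ℝ) × (κ → ℝ) × ℝ,
    (∑ i ∈ A, ∑ j ∈ B, (w i j - p.1 i - p.2.1 j - p.2.2) ^ 2) /
      (((A.card : ℝ) - 1) * ((B.card : ℝ) - 1))

/-- The set of `k` such that `w` contains a `⌈β k⌉ × k` submatrix `U` with `G(U) ≤ τ`. -/
def anovaSizes {ι κ : Type*} (τ β : ℝ) (w : Matrix ι κ ℝ) : Set ℕ :=
  {k | ∃ (A : Finset ι) (B : Finset κ),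
    A.card = ⌈β * k⌉₊ ∧ B.card = k ∧ anovaFit w A B ≤ τ}

/-- The largest `k` such that `w` contains a `⌈β k⌉ × k` submatrix `U` with `G(U) ≤ τ`. -/
def maxAnovaSize {ι κ : Type*} (τ β : ℝ) (w : Matrix ι κ ℝ) : ℕ :=
  sSup (anovaSizes τ β w)

/-- For a matrix with finitely many columns the largest such `k` really exists. -/
theorem isGreatest_maxAnovaSize {ι κ : Type*} [Fintype κ] {τ : ℝ} (hτ : 0 ≤ τ) (β : ℝ)
    (w : Matrix ι κ ℝ) : IsGreatest (anovaSizes τ β w) (maxAnovaSize τ β w) := by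
  have hb : BddAbove (anovaSizes τ β w) := by
    refine ⟨Fintype.card κ, ?_⟩
    rintro k ⟨A, B, -, hB, -⟩
    exact hB ▸ Finset.card_le_univ B
  have hne : (anovaSizes τ β w).Nonempty :=
    ⟨0, ∅, ∅, by simp, by simp, by simpa [anovaFit] using hτ⟩
  exact ⟨Nat.sSup_mem hne hb, fun k hk => le_csSup hb hk⟩

/-- The rate `h(τ) = 1 - τ - ln (2 - τ)`. -/
def anovaRate (τ : ℝ) : ℝ := 1 - τ - Real.log (2 - τ)

/-- The size threshold `t(n, τ, α, β)`, with `C` as its additive constant. -/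
def anovaThreshold (C : ℝ) (n : ℕ) (τ α β : ℝ) : ℝ :=
  2 * (1 + β⁻¹) / anovaRate τ * Real.log n
    - 2 * (1 + β⁻¹) / anovaRate τ * Real.log (2 * (1 + β⁻¹) / anovaRate τ * Real.log n)
    + (anovaRate τ)⁻¹ * Real.log α + C

end

/-! The proof is a first-moment bound. For a fixed `p × k` submatrix, products of row and column
contrasts give `d = (p-1)(k-1)` independent standard Gaussians whose squares sum to at most the
residual sum of squares. Chernoff then bounds the probability of `G(U) ≤ τ` by `exp(-d H / 2)`,
where `H = τ - 1 - ln τ` (`measureReal_anovaFit_le`).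

The decisive point is that `h(τ) < H` strictly (`anovaRate_lt`). The threshold is built from the
smaller rate, so at `k` of order `ln n` the exponent has a surplus of order `(ln n)²`. This absorbs
the `ln ln n` term, `ln α`, the additive constant and a further factor `n⁻¹` (`exponent_bound`).
That factor pays for the sum over at most `n` sizes, and the logarithmic factor of the stated bound
only has to be at least one. -/

/-! ### Lower tail of the chi-squared law -/

/-- The Laplace transform of the square of a standard Gaussian variable. -/
theorem mgf_sq_of_hasLaw_gaussianReal {Ω : Type*} [MeasurableSpace Ω] {P : Measure Ω}
    {Z : Ω → ℝ} (hZ : HasLaw Z (gaussianReal 0 1) P) {s : ℝ} (hs : -(1 / 2) < s) :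
    mgf (fun ω => Z ω ^ 2) P (-s) = (Real.sqrt (1 + 2 * s))⁻¹ := by
  have h1 : mgf (fun ω => Z ω ^ 2) P (-s) = ∫ x, Real.exp (-s * x ^ 2) ∂(gaussianReal 0 1) := by
    unfold mgf
    exact hZ.integral_comp (f := fun x : ℝ => Real.exp (-s * x ^ 2))
      (by fun_prop)
  rw [h1, integral_gaussianReal_eq_integral_smul one_ne_zero]
  have h2 : ∀ x : ℝ, gaussianPDFReal 0 1 x • Real.exp (-s * x ^ 2)
      = (Real.sqrt (2 * Real.pi))⁻¹ * Real.exp (-(1 / 2 + s) * x ^ 2) := by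
    intro x
    simp only [gaussianPDFReal, NNReal.coe_one, mul_one, sub_zero, smul_eq_mul]
    rw [mul_assoc, ← Real.exp_add]
    ring_nf
  simp_rw [h2]
  rw [integral_const_mul, integral_gaussian, ← Real.sqrt_inv, ← Real.sqrt_inv,
    ← Real.sqrt_mul (by positivity)]
  congr 1
  have : 1 / 2 + s ≠ 0 := by linarith
  have : 1 + 2 * s ≠ 0 := by linarith
  have := Real.pi_ne_zero
  field_simp

/-- Chernoff bound for the lower tail of a chi-squared variable. -/
theorem measureReal_sum_sq_le {Ω ι : Type*} [MeasurableSpace Ω] {P : Measure Ω}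
    [IsProbabilityMeasure P] [Fintype ι] {Z : ι → Ω → ℝ}
    (hZ : ∀ i, HasLaw (Z i) (gaussianReal 0 1) P) (hi : iIndepFun Z P)
    {τ : ℝ} (hτ0 : 0 < τ) (hτ1 : τ < 1) :
    P.real {ω | ∑ i, Z i ω ^ 2 ≤ τ * Fintype.card ι} ≤
      Real.exp (-(Fintype.card ι * (τ - 1 - Real.log τ) / 2)) := by
  -- The minimizer of `exp(s τ d) (1 + 2 s)^(-d/2)`, characterized by `1 + 2 s = τ⁻¹`.
  set s : ℝ := (τ⁻¹ - 1) / 2 with hs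
  have hinv : 1 < τ⁻¹ := (one_lt_inv₀ hτ0).2 hτ1
  have hs0 : 0 < s := by simp only [hs]; linarith
  have hm : ∀ i, AEMeasurable (fun ω => Z i ω ^ 2) P := fun i =>
    (hZ i).aemeasurable.pow_const 2
  have hi2 : iIndepFun (fun i ω => Z i ω ^ 2) P :=
    hi.comp (fun _ x => x ^ 2) (fun _ => by fun_prop)
  have hmgf : mgf (∑ i, fun ω => Z i ω ^ 2) P (-s) = (Real.sqrt τ) ^ Fintype.card ι := by
    rw [hi2.mgf_sum₀ hm]
    rw [Finset.prod_congr rfl fun i _ => mgf_sq_of_hasLaw_gaussianReal (hZ i) (by linarith)]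
    have : 1 + 2 * s = τ⁻¹ := by simp only [hs]; ring
    rw [this, Real.sqrt_inv, inv_inv, Finset.prod_const, Finset.card_univ]
  have hint : Integrable (fun ω => Real.exp (-s * (∑ i, fun ω => Z i ω ^ 2) ω)) P := by
    refine Integrable.of_bound (C := 1) ?_ (Filter.Eventually.of_forall fun ω => ?_)
    · refine AEMeasurable.aestronglyMeasurable ?_
      refine Real.measurable_exp.comp_aemeasurable (AEMeasurable.const_mul ?_ _)
      exact Finset.aemeasurable_sum _ fun i _ => hm i
    · rw [Real.norm_eq_abs, abs_of_pos (Real.exp_pos _), Real.exp_le_one_iff]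
      have : 0 ≤ (∑ i, fun ω => Z i ω ^ 2) ω := by
        rw [Finset.sum_apply]; positivity
      nlinarith
  have h := measure_le_le_exp_mul_mgf (X := ∑ i, fun ω => Z i ω ^ 2) (μ := P) (t := -s)
    (τ * Fintype.card ι) (by linarith) hint
  rw [hmgf] at h
  simp only [Finset.sum_apply] at h
  refine h.trans (le_of_eq ?_)
  have hsq : Real.sqrt τ = Real.exp (Real.log τ / 2) := by
    rw [← Real.log_sqrt hτ0.le, Real.exp_log (Real.sqrt_pos.2 hτ0)]
  rw [hsq, ← Real.exp_nat_mul, ← Real.exp_add]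
  congr 1
  simp only [hs]
  field_simp
  ring

/-! ### Contrasts and the residual sum of squares -/

/-- An orthonormal system of contrasts on a nonempty finite type. -/
theorem exists_orthonormal_sum_eq_zero (ι : Type*) [Fintype ι] [Nonempty ι] :
    ∃ u : Fin (Fintype.card ι - 1) → EuclideanSpace ℝ ι,
      Orthonormal ℝ u ∧ ∀ i, ∑ a, u i a = 0 := by
  let e : EuclideanSpace ℝ ι := WithLp.toLp 2 fun _ => 1
  have he : e ≠ 0 := by
    intro h
    have := congrArg (fun v : EuclideanSpace ℝ ι => v (Classical.arbitrary ι)) h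
    simp [e] at this
  have hc : 0 < Fintype.card ι := Fintype.card_pos
  have : Fact (Module.finrank ℝ (EuclideanSpace ℝ ι) = (Fintype.card ι - 1) + 1) :=
    ⟨by rw [finrank_euclideanSpace]; omega⟩
  -- Orthogonality to the all-ones vector is exactly the zero-sum condition.
  let b := OrthonormalBasis.fromOrthogonalSpanSingleton (𝕜 := ℝ) (Fintype.card ι - 1) he
  refine ⟨fun i => (b i : EuclideanSpace ℝ ι), ?_, fun i => ?_⟩
  · exact b.orthonormal.comp_linearIsometry (Submodule.subtypeₗᵢ _)
  · have := Submodule.mem_orthogonal_singleton_iff_inner_right.1 (b i).2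
    simpa [PiLp.inner_apply, e] using this

/-- Tensor products of orthonormal systems are orthonormal. -/
theorem orthonormal_tensor {ι κ I J : Type*} [Fintype ι] [Fintype κ]
    {u : I → EuclideanSpace ℝ ι} {v : J → EuclideanSpace ℝ κ}
    (hu : Orthonormal ℝ u) (hv : Orthonormal ℝ v) :
    Orthonormal ℝ (fun p : I × J =>
      (WithLp.toLp 2 fun x : ι × κ => u p.1 x.1 * v p.2 x.2 : EuclideanSpace ℝ (ι × κ))) := by
  classical
  rw [orthonormal_iff_ite] at hu hv ⊢
  intro p q
  have : inner ℝ (WithLp.toLp 2 fun x : ι × κ => u p.1 x.1 * v p.2 x.2 : EuclideanSpace ℝ (ι × κ))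
      (WithLp.toLp 2 fun x : ι × κ => u q.1 x.1 * v q.2 x.2 : EuclideanSpace ℝ (ι × κ))
      = inner ℝ (u p.1) (u q.1) * inner ℝ (v p.2) (v q.2) := by
    simp only [PiLp.inner_apply, Fintype.sum_prod_type, Finset.sum_mul_sum]
    refine Finset.sum_congr rfl fun a _ => Finset.sum_congr rfl fun b _ => ?_
    simp only [RCLike.inner_apply, conj_trivial]
    ring
  rw [this, hu, hv]
  by_cases h1 : p.1 = q.1 <;> by_cases h2 : p.2 = q.2 <;> simp [h1, h2, Prod.ext_iff]

/-- Coordinates of a standard Gaussian vector along an orthonormal system are independent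
standard Gaussian variables. -/
theorem gaussian_coordinates {Ω κ I : Type*} [MeasurableSpace Ω] {P : Measure Ω}
    [Fintype κ] [Finite I] {X : κ → Ω → ℝ}
    (hX : ∀ x, HasLaw (X x) (gaussianReal 0 1) P) (hi : iIndepFun X P)
    {e : I → EuclideanSpace ℝ κ} (he : Orthonormal ℝ e) :
    (∀ i, HasLaw (fun ω => ∑ x, e i x * X x ω) (gaussianReal 0 1) P) ∧
      iIndepFun (fun i ω => ∑ x, e i x * X x ω) P := by
  classical
  have hP : IsProbabilityMeasure P := hi.isProbabilityMeasure
  have := Fintype.ofFinite I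
  have hG : ∀ x, HasGaussianLaw (X x) P := fun x => (hX x).hasGaussianLaw
  have hm : ∀ x, MemLp (X x) 2 P := fun x => (hG x).memLp_two
  have hjoint : HasGaussianLaw (fun ω => (X · ω)) P := hi.hasGaussianLaw hG
  let T : (κ → ℝ) →L[ℝ] (I → ℝ) := ContinuousLinearMap.pi fun i =>
    ∑ x, (e i x) • ContinuousLinearMap.proj (R := ℝ) (φ := fun _ : κ => ℝ) x
  -- Joint Gaussianity is what lets zero covariance imply independence below.
  have hZ : HasGaussianLaw (fun ω i => ∑ x, e i x * X x ω) P := by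
    have hT : (fun ω i => ∑ x, e i x * X x ω) = fun ω => T (X · ω) := by
      ext ω i
      simp [T]
    rw [hT]
    exact hjoint.map_fun T
  have hcX : ∀ x y, cov[X x, X y; P] = if x = y then 1 else 0 := by
    intro x y
    split_ifs with h
    · subst h
      rw [covariance_self (hX x).aemeasurable, (hX x).variance_eq, variance_id_gaussianReal]
      simp
    · exact (hi.indepFun h).covariance_eq_zero (hm x) (hm y)
  have hcov : ∀ i j, cov[fun ω => ∑ x, e i x * X x ω, fun ω => ∑ x, e j x * X x ω; P]
      = if i = j then 1 else 0 := by
    intro i j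
    rw [covariance_fun_sum_fun_sum (fun x => (hm x).const_mul _) (fun x => (hm x).const_mul _),
      ← orthonormal_iff_ite.1 he i j]
    simp only [covariance_const_mul_left, covariance_const_mul_right, hcX, PiLp.inner_apply,
      RCLike.inner_apply, conj_trivial]
    refine Finset.sum_congr rfl fun x _ => ?_
    simp [mul_comm]
  refine ⟨fun i => ?_, hZ.iIndepFun_of_covariance_eq_zero fun i j hij => by rw [hcov, if_neg hij]⟩
  have hZi : HasGaussianLaw (fun ω => ∑ x, e i x * X x ω) P := hZ.eval i
  refine ⟨hZi.aemeasurable, ?_⟩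
  rw [hZi.map_eq_gaussianReal, ← covariance_self hZi.aemeasurable, hcov, if_pos rfl,
    integral_finsetSum _ fun x _ => (hG x).integrable.const_mul _]
  congr 1
  · refine Finset.sum_eq_zero fun x _ => ?_
    rw [integral_const_mul, (hX x).integral_eq]
    simp
  · simp

/-- Bessel's inequality for the residual sum of squares of the additive fit. -/
theorem sum_sq_contrasts_le {ι κ I J : Type*} [Fintype ι] [Fintype κ] [Fintype I] [Fintype J]
    {u : I → EuclideanSpace ℝ ι} {v : J → EuclideanSpace ℝ κ}
    (hu : Orthonormal ℝ u) (hv : Orthonormal ℝ v)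
    (hu0 : ∀ i, ∑ a, u i a = 0) (hv0 : ∀ j, ∑ b, v j b = 0)
    (w : ι → κ → ℝ) (a : ι → ℝ) (b : κ → ℝ) (c : ℝ) :
    ∑ p : I × J, (∑ x : ι × κ, u p.1 x.1 * v p.2 x.2 * w x.1 x.2) ^ 2 ≤
      ∑ i, ∑ j, (w i j - a i - b j - c) ^ 2 := by
  have h := (orthonormal_tensor hu hv).sum_inner_products_le (s := Finset.univ)
    (WithLp.toLp 2 fun x : ι × κ => w x.1 x.2 - a x.1 - b x.2 - c : EuclideanSpace ℝ (ι × κ))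
  rw [EuclideanSpace.real_norm_sq_eq, Fintype.sum_prod_type (γ := ℝ) (α₁ := ι)] at h
  refine le_of_eq_of_le (Finset.sum_congr rfl fun p _ => ?_) h
  rw [Real.norm_eq_abs, sq_abs]
  congr 1
  simp only [PiLp.inner_apply, RCLike.inner_apply, conj_trivial]
  rw [Fintype.sum_prod_type, Fintype.sum_prod_type]
  -- Zero-sum contrasts annihilate every additive term, so the coefficients of the residuals are
  -- those of `w`.
  have h1 : ∑ i, ∑ j, u p.1 i * v p.2 j * a i = 0 := by
    refine Finset.sum_eq_zero fun i _ => ?_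
    rw [← Finset.sum_mul, ← Finset.mul_sum, hv0]; ring
  have h2 : ∑ i, ∑ j, u p.1 i * v p.2 j * b j = 0 := by
    rw [Finset.sum_comm]
    refine Finset.sum_eq_zero fun j _ => ?_
    rw [← Finset.sum_mul, ← Finset.sum_mul, hu0]; ring
  have h3 : ∑ i, ∑ j, u p.1 i * v p.2 j * c = 0 := by
    refine Finset.sum_eq_zero fun i _ => ?_
    rw [← Finset.sum_mul, ← Finset.mul_sum, hv0]; ring
  have : ∑ i, ∑ j, (w i j - a i - b j - c) * (u p.1 i * v p.2 j) =
      ∑ i, ∑ j, u p.1 i * v p.2 j * w i j - ∑ i, ∑ j, u p.1 i * v p.2 j * a i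
      - ∑ i, ∑ j, u p.1 i * v p.2 j * b j - ∑ i, ∑ j, u p.1 i * v p.2 j * c := by
    simp only [← Finset.sum_sub_distrib]
    refine Finset.sum_congr rfl fun i _ => Finset.sum_congr rfl fun j _ => ?_
    ring
  rw [this, h1, h2, h3]
  simp

/-- The probability that a fixed submatrix of a Gaussian matrix has `G(U) ≤ τ`. -/
theorem measureReal_anovaFit_le {Ω ι κ : Type*} [MeasurableSpace Ω] {P : Measure Ω}
    [IsProbabilityMeasure P] {W : Ω → Matrix ι κ ℝ} (hW : IsGaussianMatrix P W)
    {τ : ℝ} (hτ0 : 0 < τ) (hτ1 : τ < 1) {A : Finset ι} {B : Finset κ}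
    (hA : 2 ≤ A.card) (hB : 2 ≤ B.card) :
    P.real {ω | anovaFit (W ω) A B ≤ τ} ≤
      Real.exp (-((A.card - 1) * (B.card - 1) * (τ - 1 - Real.log τ) / 2)) := by
  have : Nonempty A := (Finset.card_pos.1 (by omega)).to_subtype
  have : Nonempty B := (Finset.card_pos.1 (by omega)).to_subtype
  obtain ⟨u, hu, hu0⟩ := exists_orthonormal_sum_eq_zero A
  obtain ⟨v, hv, hv0⟩ := exists_orthonormal_sum_eq_zero B
  have hX : iIndepFun (fun (x : A × B) ω => W ω x.1 x.2) P :=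
    hW.indep.precomp (g := fun x : A × B => ((x.1 : ι), (x.2 : κ))) fun x y h =>
      Prod.ext (Subtype.ext (congrArg Prod.fst h)) (Subtype.ext (congrArg Prod.snd h))
  obtain ⟨h1, h2⟩ := gaussian_coordinates (fun x : A × B => hW.hasLaw x.1 x.2) hX
    (orthonormal_tensor hu hv)
  have h := measureReal_sum_sq_le h1 h2 hτ0 hτ1
  have hcard : (Fintype.card (Fin (Fintype.card A - 1) × Fin (Fintype.card B - 1)) : ℝ)
      = ((A.card : ℝ) - 1) * ((B.card : ℝ) - 1) := by
    simp only [Fintype.card_prod, Fintype.card_fin, Fintype.card_coe, Nat.cast_mul]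
    rw [Nat.cast_sub (by omega), Nat.cast_sub (by omega), Nat.cast_one]
  rw [hcard] at h
  refine (measureReal_mono fun ω hω => ?_).trans h
  have hA' : (2 : ℝ) ≤ A.card := by exact_mod_cast hA
  have hB' : (2 : ℝ) ≤ B.card := by exact_mod_cast hB
  have hd : 0 < ((A.card : ℝ) - 1) * ((B.card : ℝ) - 1) := mul_pos (by linarith) (by linarith)
  rw [Set.mem_ofPred_eq] at hω ⊢
  rw [← div_le_iff₀ hd]
  refine le_trans (le_ciInf fun p => ?_) hω
  gcongr
  refine (sum_sq_contrasts_le hu hv hu0 hv0 (fun i j => W ω i j) (fun i => p.1 i)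
    (fun j => p.2.1 j) p.2.2).trans (le_of_eq ?_)
  rw [← Finset.sum_coe_sort A]
  refine Finset.sum_congr rfl fun i _ => ?_
  rw [← Finset.sum_coe_sort B]

/-! ### Comparison of rates and the exponent -/

theorem anovaRate_pos {τ : ℝ} (hτ1 : τ < 1) : 0 < anovaRate τ := by
  have := Real.log_lt_sub_one_of_pos (x := 2 - τ) (by linarith) (by linarith)
  unfold anovaRate
  linarith

/-- The rate `h(τ)` is strictly smaller than the large deviation rate of the chi-squared law. -/
theorem anovaRate_lt {τ : ℝ} (hτ0 : 0 < τ) (hτ1 : τ < 1) :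
    anovaRate τ < τ - 1 - Real.log τ := by
  have hx : 0 < 2 * (1 - τ) / τ := div_pos (by linarith) hτ0
  -- The bound `2x/(x+2) < ln(1+x)` at this `x` reads `2(1-τ) < ln((2-τ)/τ)`, which is `h(τ) < H`
  -- rearranged.
  have h := Real.lt_log_one_add_of_pos hx
  have h1 : 2 * (2 * (1 - τ) / τ) / (2 * (1 - τ) / τ + 2) = 2 * (1 - τ) := by
    field_simp
    ring
  have h2 : 1 + 2 * (1 - τ) / τ = (2 - τ) / τ := by
    field_simp
    ring
  rw [h1, h2, Real.log_div (by linarith) hτ0.ne'] at h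
  unfold anovaRate
  linarith

/-- The exponent in the union bound, for sizes beyond a threshold slightly below `A * N`. -/
theorem exponent_bound {β h H A N c δ t r k p : ℝ} (hβ : 1 ≤ β) (hh : 0 < h) (hH : h < H)
    (hA : A * (β * h) = 2 * (β + 1)) (hδ : δ * (8 * H) = H - h)
    (hN : 0 < N) (hcN : β * c ≤ N)
    (hN1 : β * c + (β + 1) * H / 2 ≤ β * (H - h) / 8 * (A * N / 2))
    (hN2 : 1 ≤ β * (H - h) / 8 * (A / 2) * (A * N / 2))
    (ht : (1 - δ) * (A * N) ≤ t) (hr : 1 ≤ r) (hk : t + r ≤ k) (hp : β * k ≤ p) :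
    k * N + p * (N + c) - (p - 1) * (k - 1) * H / 2 ≤ -(β + 1) * r * N - N := by
  have hH0 : 0 < H := hh.trans hH
  have hA0 : 0 < A := by
    by_contra hneg
    have : A * (β * h) ≤ 0 := mul_nonpos_of_nonpos_of_nonneg (not_lt.1 hneg) (by positivity)
    linarith
  have hAN : 0 < A * N := mul_pos hA0 hN
  have hδ1 : δ ≤ 1 / 8 := by
    by_contra hneg
    nlinarith [not_le.1 hneg]
  have hk2 : A * N / 2 ≤ k := by nlinarith
  have hk0 : 0 < k := by linarith
  -- monotonicity in the number of rows
  have hslope : N + c ≤ (k - 1) * H / 2 := by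
    have h1 : h ≤ (1 - δ) * H := by nlinarith
    have h2 : (1 - δ) * (A * N) ≤ k - 1 := by linarith
    have h3 : A * N * h ≤ (k - 1) * H := by nlinarith
    have h4 : β * (N + c) ≤ β * ((k - 1) * H / 2) := by
      have : β * (A * N * h) = 2 * (β + 1) * N := by rw [← hA]; ring
      nlinarith
    exact le_of_mul_le_mul_left h4 (by linarith)
  have hrows : p * (N + c) - (p - 1) * (k - 1) * H / 2 ≤
      β * k * (N + c) - (β * k - 1) * (k - 1) * H / 2 := by
    linarith [mul_nonneg (sub_nonneg.2 hp) (sub_nonneg.2 hslope)]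
  -- the quadratic in `k`
  have hrt : r * N ≤ (k - t) * N := mul_le_mul_of_nonneg_right (by linarith) hN.le
  have htN : (1 - δ) * (A * N) * N ≤ t * N := mul_le_mul_of_nonneg_right ht hN.le
  -- Tangent line at `k = A N`: `(β+1)kN - βhk²/2 ≤ -(β+1)(k - A N)N`. The surplus `β(H-h)k²/2` is
  -- then split into a quarter for the `δ` loss, an eighth for the terms linear in `k` and an eighth
  -- for the extra `-N`.
  have hsq : 0 ≤ β * h / 2 * (k - A * N) ^ 2 := by positivity
  have hexp : β * h / 2 * (k - A * N) ^ 2 =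
      β * h / 2 * k ^ 2 - 2 * (β + 1) * k * N + (β + 1) * (A * N) * N := by
    linear_combination (-k * N + A * N ^ 2 / 2) * hA
  have hδAN : (β + 1) * δ * (A * N) * N ≤ β * (H - h) / 4 * k ^ 2 := by
    have h1 : (β + 1) * δ * (A * N) * N = β * h * δ * (A * N) ^ 2 / 2 := by
      linear_combination (-δ * A * N ^ 2 / 2) * hA
    have h2 : h * δ ≤ (H - h) / 8 := by
      have : 0 ≤ δ := by
        by_contra hneg
        nlinarith [not_le.1 hneg]
      nlinarith
    have h3 : (A * N) ^ 2 ≤ 4 * k ^ 2 := by nlinarith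
    have h4 : h * δ * (A * N) ^ 2 ≤ (H - h) / 8 * (4 * k ^ 2) :=
      mul_le_mul h2 h3 (by positivity) (by linarith)
    rw [h1]
    linarith [mul_le_mul_of_nonneg_left h4 (show 0 ≤ β / 2 by linarith)]
  have hg : 0 < β * (H - h) / 8 := by
    have : 0 < H - h := by linarith
    positivity
  have hlin : (β * c + (β + 1) * H / 2) * k ≤ β * (H - h) / 8 * k ^ 2 := by
    have : β * c + (β + 1) * H / 2 ≤ β * (H - h) / 8 * k :=
      hN1.trans (mul_le_mul_of_nonneg_left hk2 hg.le)
    linarith [mul_le_mul_of_nonneg_right this hk0.le]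
  have hNk : N ≤ β * (H - h) / 8 * k ^ 2 := by
    have h3 : (A * N / 2) ^ 2 ≤ k ^ 2 := by gcongr
    have h4 := mul_le_mul_of_nonneg_left h3 hg.le
    have h5 := mul_le_mul_of_nonneg_right hN2 hN.le
    linarith
  have hβ1 : 0 ≤ β + 1 := by linarith
  linarith [mul_le_mul_of_nonneg_left hrt hβ1, mul_le_mul_of_nonneg_left htN hβ1]

/-- The threshold is asymptotically at least `(1 - δ) A ln n`. -/
theorem eventually_le_anovaThreshold {τ β α δ : ℝ} (C : ℝ) (hτ1 : τ < 1) (hβ : 1 ≤ β)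
    (hδ : 0 < δ) :
    ∀ᶠ n : ℕ in Filter.atTop,
      (1 - δ) * (2 * (1 + β⁻¹) / anovaRate τ * Real.log n) ≤ anovaThreshold C n τ α β := by
  have hh := anovaRate_pos hτ1
  set A := 2 * (1 + β⁻¹) / anovaRate τ with hA
  have hA0 : 0 < A := by positivity
  have htend : Filter.Tendsto (fun n : ℕ => A * Real.log n) Filter.atTop Filter.atTop :=
    (Real.tendsto_log_atTop.comp tendsto_natCast_atTop_atTop).const_mul_atTop hA0
  -- With `x = A ln n`, half of the allowed loss `δ x` covers `A ln x`, the other half the constant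
  -- terms.
  have h1 := htend.eventually
    (Real.isLittleO_log_id_atTop.bound (show 0 < δ / (2 * A) by positivity))
  have h2 := htend.eventually_ge_atTop (-2 * ((anovaRate τ)⁻¹ * Real.log α + C) / δ)
  have h3 := htend.eventually_ge_atTop 0
  filter_upwards [h1, h2, h3] with n h1 h2 h3
  unfold anovaThreshold
  rw [← hA]
  generalize A * Real.log n = x at h1 h2 h3 ⊢
  rw [id, Real.norm_eq_abs, Real.norm_eq_abs, abs_of_nonneg h3] at h1
  have h4 : A * Real.log x ≤ δ / 2 * x := by
    calc A * Real.log x ≤ A * (δ / (2 * A) * x) :=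
          mul_le_mul_of_nonneg_left ((le_abs_self _).trans h1) hA0.le
      _ = δ / 2 * x := by field_simp
  rw [div_le_iff₀ hδ] at h2
  linarith

/-- Each term of the union bound is small beyond the threshold. -/
theorem eventually_union_term_le {τ β α : ℝ} (C : ℝ) (hτ0 : 0 < τ) (hτ1 : τ < 1) (hβ : 1 ≤ β)
    (hα : 0 < α) :
    ∀ᶠ n : ℕ in Filter.atTop, ∀ r : ℝ, 1 ≤ r → ∀ k : ℕ, anovaThreshold C n τ α β + r ≤ k →
      2 ≤ k ∧ (n : ℝ) ^ k * (⌈α * n⌉₊ : ℝ) ^ ⌈β * k⌉₊ *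
        Real.exp (-(((⌈β * k⌉₊ : ℝ) - 1) * ((k : ℝ) - 1) * (τ - 1 - Real.log τ) / 2)) ≤
          (n : ℝ) ^ (-(β + 1) * r) * (n : ℝ)⁻¹ := by
  have hh := anovaRate_pos hτ1
  have hH := anovaRate_lt hτ0 hτ1
  set h := anovaRate τ
  set H := τ - 1 - Real.log τ
  have hH0 : 0 < H := hh.trans hH
  set A := 2 * (1 + β⁻¹) / h with hA
  have hA0 : 0 < A := by positivity
  have hA' : A * (β * h) = 2 * (β + 1) := by
    rw [hA]; field_simp
  set δ := (H - h) / (8 * H) with hδ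
  have hHh : 0 < H - h := by linarith
  have hδ0 : 0 < δ := by positivity
  have hδ' : δ * (8 * H) = H - h := by rw [hδ]; field_simp
  -- Chosen so that `⌈α n⌉ ≤ (α + 1) n = exp(ln n + c)` for `n ≥ 1`.
  set c := Real.log (α + 1)
  have hlog : Filter.Tendsto (fun n : ℕ => Real.log n) Filter.atTop Filter.atTop :=
    Real.tendsto_log_atTop.comp tendsto_natCast_atTop_atTop
  have ht := eventually_le_anovaThreshold (α := α) C hτ1 hβ hδ0
  filter_upwards [ht, hlog.eventually_gt_atTop 0, hlog.eventually_ge_atTop (β * c),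
    ((hlog.const_mul_atTop hA0).atTop_div_const two_pos).const_mul_atTop
      (show 0 < β * (H - h) / 8 by positivity)
      |>.eventually_ge_atTop (β * c + (β + 1) * H / 2),
    ((hlog.const_mul_atTop hA0).atTop_div_const two_pos).const_mul_atTop
      (show 0 < β * (H - h) / 8 * (A / 2) by positivity) |>.eventually_ge_atTop 1,
    Filter.eventually_ge_atTop 1]
    with n ht hN hcN hN1 hN2 hn r hr k hk
  have hδ1 : δ < 1 := by rw [hδ, div_lt_one (by positivity)]; linarith
  have htpos : 0 < anovaThreshold C n τ α β :=
    lt_of_lt_of_le (mul_pos (by linarith) (mul_pos hA0 hN)) ht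
  have hk2 : 2 ≤ k := by
    have : (1 : ℝ) < k := by linarith
    exact_mod_cast this
  refine ⟨hk2, ?_⟩
  have hn0 : (0 : ℝ) < n := by exact_mod_cast hn
  have hn1 : (1 : ℝ) ≤ n := by exact_mod_cast hn
  have hm : (⌈α * n⌉₊ : ℝ) ≤ Real.exp (Real.log n + c) := by
    rw [Real.exp_add, Real.exp_log hn0, Real.exp_log (by linarith)]
    have := (Nat.ceil_lt_add_one (show 0 ≤ α * n by positivity)).le
    linarith
  have hb := exponent_bound (p := (⌈β * k⌉₊ : ℝ)) hβ hh hH hA' hδ' hN hcN hN1 hN2 ht hr hk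
    (Nat.le_ceil _)
  calc _ ≤ Real.exp (Real.log n) ^ k * Real.exp (Real.log n + c) ^ ⌈β * k⌉₊ *
        Real.exp (-(((⌈β * k⌉₊ : ℝ) - 1) * ((k : ℝ) - 1) * H / 2)) := by
        gcongr
        rw [Real.exp_log hn0]
    _ = Real.exp (k * Real.log n + ⌈β * k⌉₊ * (Real.log n + c)
          - ((⌈β * k⌉₊ : ℝ) - 1) * ((k : ℝ) - 1) * H / 2) := by
        rw [← Real.exp_nat_mul, ← Real.exp_nat_mul, ← Real.exp_add, ← Real.exp_add]
        ring_nf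
    _ ≤ Real.exp (-(β + 1) * r * Real.log n - Real.log n) := Real.exp_le_exp.2 hb
    _ = (n : ℝ) ^ (-(β + 1) * r) * (n : ℝ)⁻¹ := by
        rw [Real.rpow_def_of_pos hn0, Real.exp_sub, Real.exp_log hn0, div_eq_mul_inv]
        ring_nf

/-! ### Union bounds over submatrices and over sizes -/

/-- Union bound over all submatrices of size `⌈β k⌉ × k`. -/
theorem measureReal_mem_anovaSizes_le {Ω : Type*} [MeasurableSpace Ω] {P : Measure Ω}
    [IsProbabilityMeasure P] {m n : ℕ} {W : Ω → Matrix (Fin m) (Fin n) ℝ}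
    (hW : IsGaussianMatrix P W) {τ β : ℝ} (hτ0 : 0 < τ) (hτ1 : τ < 1) (hβ : 1 ≤ β)
    {k : ℕ} (hk : 2 ≤ k) :
    P.real {ω | k ∈ anovaSizes τ β (W ω)} ≤
      (n : ℝ) ^ k * (m : ℝ) ^ ⌈β * k⌉₊ *
        Real.exp (-(((⌈β * k⌉₊ : ℝ) - 1) * ((k : ℝ) - 1) * (τ - 1 - Real.log τ) / 2)) := by
  set p := ⌈β * k⌉₊
  have hp : 2 ≤ p := by
    have h1 : (k : ℝ) ≤ p := le_trans (le_mul_of_one_le_left (by positivity) hβ) (Nat.le_ceil _)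
    exact hk.trans (by exact_mod_cast h1)
  set S := Finset.powersetCard p (Finset.univ : Finset (Fin m)) ×ˢ
    Finset.powersetCard k (Finset.univ : Finset (Fin n)) with hS
  set q := Real.exp (-(((p : ℝ) - 1) * ((k : ℝ) - 1) * (τ - 1 - Real.log τ) / 2))
  have hsub : {ω | k ∈ anovaSizes τ β (W ω)} ⊆
      ⋃ s ∈ S, {ω | anovaFit (W ω) s.1 s.2 ≤ τ} := by
    rintro ω ⟨A, B, hA, hB, hAB⟩
    simp only [Set.mem_iUnion]
    exact ⟨(A, B), by simp [hS, Finset.mem_powersetCard, hA, hB, p], hAB⟩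
  calc _ ≤ P.real (⋃ s ∈ S, {ω | anovaFit (W ω) s.1 s.2 ≤ τ}) := measureReal_mono hsub (measure_ne_top _ _)
    _ ≤ ∑ s ∈ S, P.real {ω | anovaFit (W ω) s.1 s.2 ≤ τ} := measureReal_biUnion_finset_le _ _
    _ ≤ ∑ s ∈ S, q := by
        refine Finset.sum_le_sum fun s hs => ?_
        rw [hS, Finset.mem_product, Finset.mem_powersetCard, Finset.mem_powersetCard] at hs
        have h := measureReal_anovaFit_le hW hτ0 hτ1 (A := s.1) (B := s.2)
          (by rw [hs.1.2]; exact hp) (by rw [hs.2.2]; exact hk)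
        rwa [hs.1.2, hs.2.2] at h
    _ = (n.choose k : ℝ) * (m.choose p : ℝ) * q := by
        rw [Finset.sum_const, nsmul_eq_mul, hS, Finset.card_product, Finset.card_powersetCard,
          Finset.card_powersetCard, Finset.card_univ, Finset.card_univ, Fintype.card_fin,
          Fintype.card_fin]
        push_cast
        ring
    _ ≤ (n : ℝ) ^ k * (m : ℝ) ^ p * q := by
        gcongr
        · exact_mod_cast Nat.choose_le_pow n k
        · exact_mod_cast Nat.choose_le_pow m p

theorem proposition4 (τ β : ℝ) (hτ0 : 0 < τ) (hτ1 : τ < 1) (hβ : 1 ≤ β) :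
    ∃ C₂ : ℝ, 0 < C₂ ∧ ∀ α : ℝ, 0 < α → ∀ ε : ℝ, 0 < ε →
      ∃ n₀ : ℕ, ∀ n : ℕ, n₀ ≤ n →
        ∀ (Ω : Type*) [MeasurableSpace Ω] (P : Measure Ω) [IsProbabilityMeasure P]
          (W : Ω → Matrix (Fin ⌈α * n⌉₊) (Fin n) ℝ), IsGaussianMatrix P W →
          ∀ r : ℝ, 1 ≤ r → r ≤ n →
            P.real {ω | anovaThreshold C₂ n τ α β + r ≤ (maxAnovaSize τ β (W ω) : ℝ)} ≤
              (n : ℝ) ^ (-(β + 1) * r) *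
                (Real.log n / anovaRate τ) ^ ((β + 1 + ε) * r) := by
  -- Any positive constant would serve: the strict gap between the rates absorbs it.
  refine ⟨1, one_pos, fun α hα ε hε => ?_⟩
  have hlog : Filter.Tendsto (fun n : ℕ => Real.log n) Filter.atTop Filter.atTop :=
    Real.tendsto_log_atTop.comp tendsto_natCast_atTop_atTop
  obtain ⟨n₀, hn₀⟩ := Filter.eventually_atTop.1
    ((eventually_union_term_le 1 hτ0 hτ1 hβ hα).and
      ((hlog.eventually_ge_atTop (anovaRate τ)).and (Filter.eventually_ge_atTop 1)))
  refine ⟨n₀, fun n hn Ω _ P _ W hW r hr _ => ?_⟩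
  obtain ⟨hterm, hlogn, hn1⟩ := hn₀ n hn
  have hterm := hterm r hr
  have hn0 : (0 : ℝ) < n := by exact_mod_cast hn1
  set t := anovaThreshold 1 n τ α β
  set K := (Finset.Icc 1 n).filter fun k : ℕ => t + r ≤ k with hK
  have hsub : {ω | t + r ≤ (maxAnovaSize τ β (W ω) : ℝ)} ⊆
      ⋃ k ∈ K, {ω | k ∈ anovaSizes τ β (W ω)} := by
    intro ω hω
    have hω' : t + r ≤ (maxAnovaSize τ β (W ω) : ℝ) := hω
    have hmem := (isGreatest_maxAnovaSize hτ0.le β (W ω)).1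
    have h2 := (hterm _ hω').1
    have hle : maxAnovaSize τ β (W ω) ≤ n := by
      obtain ⟨A, B, -, hB, -⟩ := hmem
      simpa [hB] using Finset.card_le_univ B
    simp only [Set.mem_iUnion]
    exact ⟨_, Finset.mem_filter.2 ⟨Finset.mem_Icc.2 ⟨by omega, hle⟩, hω'⟩, hmem⟩
  have hKcard : (K.card : ℝ) ≤ n := by
    have : K.card ≤ n := (Finset.card_filter_le _ _).trans (by simp)
    exact_mod_cast this
  have hpow : 1 ≤ (Real.log n / anovaRate τ) ^ ((β + 1 + ε) * r) :=
    Real.one_le_rpow ((one_le_div (anovaRate_pos hτ1)).2 hlogn) (by positivity)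
  calc _ ≤ P.real (⋃ k ∈ K, {ω | k ∈ anovaSizes τ β (W ω)}) := measureReal_mono hsub (measure_ne_top _ _)
    _ ≤ ∑ k ∈ K, P.real {ω | k ∈ anovaSizes τ β (W ω)} := measureReal_biUnion_finset_le _ _
    _ ≤ ∑ k ∈ K, (n : ℝ) ^ (-(β + 1) * r) * (n : ℝ)⁻¹ := by
        refine Finset.sum_le_sum fun k hk => ?_
        obtain ⟨h2, h3⟩ := hterm k (Finset.mem_filter.1 hk).2
        exact (measureReal_mem_anovaSizes_le hW hτ0 hτ1 hβ h2).trans h3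
    _ = K.card * ((n : ℝ) ^ (-(β + 1) * r) * (n : ℝ)⁻¹) := by
        rw [Finset.sum_const, nsmul_eq_mul]
    _ ≤ n * ((n : ℝ) ^ (-(β + 1) * r) * (n : ℝ)⁻¹) := by gcongr
    _ = (n : ℝ) ^ (-(β + 1) * r) * 1 := by field_simp
    _ ≤ _ := by gcongr
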